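/- Let $r,d\ge 1$ be fixed integers. For a finite set $X\subset\mathbb R^d$, let $t(X,r)$ be the largest integer $t\ge 0$ for which there is a partition $A_1,\dots,A_r$ of $X$ such that $\bigcap_{i=1}^r \operatorname{conv}(A_i\setminus Y)\neq\emptyset$ for every $Y\subseteq X$ with at most $t$ points, and let $$t(n,d,r)=\min\{\,t(X,r) : X\subset\mathbb R^d,\ |X|=n\,\}.$$ Then for all sufficiently large $n$ (depending on $r$ and $d$) the maximum defining $t(X,r)$ exists for every $n$-point set $X\subset\mathbb R^d$, the minimum defining $t(n,d,r)$ exists, and $$t(n,d,r)\ \ge\ \frac nr-o(n)\qquad(n\to\infty),$$ that is, there is a function $f:\mathbb N\to\mathbb R$, depending only on $r$ and $d$, with $f(n)/n\to 0$ as $n\to\infty$ and $t(n,d,r)\ge \frac nr-f(n)$ for all sufficiently large $n$. -/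

import Mathlib

open Filter Asymptotics

/-- `A₁, …, A_r` is a partition of the finite point set `X ⊆ ℝᵈ`. Nonemptiness of the parts is not
demanded here: it follows from tolerance (take `Y = ∅` in `ToleratesRemoval`). -/
def IsRPartition {d r : ℕ} (X : Finset (EuclideanSpace ℝ (Fin d)))
    (A : Fin r → Finset (EuclideanSpace ℝ (Fin d))) : Prop :=
  (∀ i j, i ≠ j → Disjoint (A i) (A j)) ∧
    (⋃ i, (A i : Set (EuclideanSpace ℝ (Fin d)))) = (X : Set (EuclideanSpace ℝ (Fin d)))

/-- The sets `conv (Aᵢ \ Y)` have a common point for every `Y ⊆ X` with at most `t` points. -/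
def ToleratesRemoval {d r : ℕ} (X : Finset (EuclideanSpace ℝ (Fin d)))
    (A : Fin r → Finset (EuclideanSpace ℝ (Fin d))) (t : ℕ) : Prop :=
  ∀ Y : Finset (EuclideanSpace ℝ (Fin d)), Y ⊆ X → Y.card ≤ t →
    (⋂ i, convexHull ℝ ((A i : Set (EuclideanSpace ℝ (Fin d))) \
      (Y : Set (EuclideanSpace ℝ (Fin d))))).Nonempty

/-- The numbers `t` such that some partition of `X` into `r` sets tolerates the removal of any
`t` points. -/
def toleranceSet {d : ℕ} (X : Finset (EuclideanSpace ℝ (Fin d))) (r : ℕ) : Set ℕ :=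
  {t | ∃ A : Fin r → Finset (EuclideanSpace ℝ (Fin d)), IsRPartition X A ∧ ToleratesRemoval X A t}

/-- The tolerance `t(X, r)`: the maximum of `toleranceSet X r` (and `0` if there is none). -/
noncomputable def tolerance {d : ℕ} (X : Finset (EuclideanSpace ℝ (Fin d))) (r : ℕ) : ℕ :=
  sSup (toleranceSet X r)

/-- The tolerances of all `n`-point sets in `ℝᵈ`. -/
def toleranceValues (n d r : ℕ) : Set ℕ :=
  {t | ∃ X : Finset (EuclideanSpace ℝ (Fin d)), X.card = n ∧ t = tolerance X r}

/-- `t(n, d, r)`: the minimum of `t(X, r)` over all `n`-point sets `X ⊆ ℝᵈ`. -/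
noncomputable def minTolerance (n d r : ℕ) : ℕ :=
  sInf (toleranceValues n d r)

/-! Colour the n points uniformly at random with r colours. By Sarkaria's lift, a colouring
tolerates t removals once every half-space `0 ≤ φ` contains more than t of the lifted points. The r
lifts of a point sum to zero, so one of them lies in the half-space, and the expected number of hits
is at least n/r. By Chernoff, falling short by εn has probability at most exp(-nε²/4)
(`exists_colouring_many_hits`). The half-spaces cut out only polynomially many subsets of the nr
possible lifts (`card_halfSpaceTraces_le`), so a union bound leaves a colouring that is good for all
φ at once. -/

/-! ### Counting the sign patterns of linear functionals -/

/-- The index sets `{a | 0 ≤ φ (p a)}` cut out of the family `p` by closed half-spaces. -/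
noncomputable def halfSpaceTraces {α F : Type*} [Fintype α] [AddCommGroup F] [Module ℝ F]
    (p : α → F) : Finset (Finset α) := by
  classical
  exact {s | ∃ φ : F →ₗ[ℝ] ℝ, ∀ a, a ∈ s ↔ 0 ≤ φ (p a)}

lemma mem_halfSpaceTraces {α F : Type*} [Fintype α] [AddCommGroup F] [Module ℝ F]
    {p : α → F} {s : Finset α} :
    s ∈ halfSpaceTraces p ↔ ∃ φ : F →ₗ[ℝ] ℝ, ∀ a, a ∈ s ↔ 0 ≤ φ (p a) := by
  classical
  simp [halfSpaceTraces]

/-- Given a relation with coefficients `g`, shattering yields a `φ` that is nonnegative exactly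
where `g` is. Every `g b * φ (p b)` is then nonnegative, and positive where `g b < 0`, so no
coefficient is negative; `-g` gives the rest. -/
lemma linearIndependent_of_shatters_halfSpaceTraces {α F : Type*} [Fintype α] [DecidableEq α]
    [AddCommGroup F] [Module ℝ F] {p : α → F} {s : Finset α}
    (hs : (halfSpaceTraces p).Shatters s) : LinearIndependent ℝ (fun a : s => p a) := by
  have key : ∀ g : s → ℝ, ∑ a, g a • p a = 0 → ∀ a, 0 ≤ g a := by
    intro g hg a
    by_contra! ha
    obtain ⟨u, hu, hsu⟩ := hs (t := (Finset.univ.filter fun b : s => 0 ≤ g b).map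
      (Function.Embedding.subtype _)) (by intro b hb; simp at hb; exact hb.1)
    obtain ⟨φ, hφ⟩ := mem_halfSpaceTraces.1 hu
    have hmem : ∀ b : s, 0 ≤ φ (p b) ↔ 0 ≤ g b := by
      intro b
      have := congrArg (fun v => (b : α) ∈ v) hsu
      simpa [hφ] using this
    have hsum : ∑ b, g b * φ (p b) = 0 := by
      have := congrArg φ hg
      simpa using this
    have hpos : 0 < ∑ b, g b * φ (p b) := by
      refine Finset.sum_pos' (fun b _ => ?_) ⟨a, Finset.mem_univ _, ?_⟩
      · rcases le_or_gt 0 (g b) with h | h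
        · exact mul_nonneg h ((hmem b).2 h)
        · exact (mul_pos_of_neg_of_neg h (not_le.1 fun h' => h.not_ge ((hmem b).1 h'))).le
      · exact mul_pos_of_neg_of_neg ha (not_le.1 fun h' => ha.not_ge ((hmem a).1 h'))
    exact hpos.ne' hsum
  rw [Fintype.linearIndependent_iff]
  intro g hg a
  refine le_antisymm ?_ (key g hg a)
  have := key (-g)
    (by simpa only [Pi.neg_apply, neg_smul, Finset.sum_neg_distrib, neg_eq_zero]) a
  simpa using this

/-- Sauer–Shelah, with VC dimension at most the linear dimension. -/
lemma card_halfSpaceTraces_le {α F : Type*} [Fintype α] [AddCommGroup F] [Module ℝ F]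
    [FiniteDimensional ℝ F] (p : α → F) :
    (halfSpaceTraces p).card ≤
      (Module.finrank ℝ F + 1) * (Fintype.card α + 1) ^ Module.finrank ℝ F := by
  classical
  have hvc : (halfSpaceTraces p).vcDim ≤ Module.finrank ℝ F := by
    refine Finset.sup_le fun s hs => ?_
    simpa using (linearIndependent_of_shatters_halfSpaceTraces
      (Finset.mem_shatterer.1 hs)).fintype_card_le_finrank
  calc (halfSpaceTraces p).card
      ≤ (halfSpaceTraces p).shatterer.card := Finset.card_le_card_shatterer _
    _ ≤ ∑ k ∈ Finset.Iic (halfSpaceTraces p).vcDim, (Fintype.card α).choose k :=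
        Finset.card_shatterer_le_sum_vcDim
    _ ≤ ∑ k ∈ Finset.Iic (Module.finrank ℝ F), (Fintype.card α).choose k :=
        Finset.sum_le_sum_of_subset (Finset.Iic_subset_Iic.2 hvc)
    _ ≤ ∑ _k ∈ Finset.Iic (Module.finrank ℝ F),
          (Fintype.card α + 1) ^ Module.finrank ℝ F := by
        refine Finset.sum_le_sum fun k hk => (Nat.choose_le_pow _ _).trans ?_
        exact (Nat.pow_le_pow_left (Nat.le_succ _) k).trans
          (Nat.pow_le_pow_right (Nat.succ_pos _) (Finset.mem_Iic.1 hk))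
    _ = _ := by simp

/-! ### A Chernoff bound for random colourings -/

lemma exp_neg_le_one_sub_add_sq {x : ℝ} (hx : 0 ≤ x) : Real.exp (-x) ≤ 1 - x + x ^ 2 := by
  have h1 := Real.add_one_le_exp x
  rw [Real.exp_neg, inv_le_iff_one_le_mul₀ (Real.exp_pos x)]
  have h2 : 0 ≤ 1 - x + x ^ 2 := by nlinarith [sq_nonneg (x - 1)]
  have h3 : 0 ≤ x ^ 3 := by positivity
  -- (1 + x)(1 - x + x²) = 1 + x³.
  nlinarith [mul_le_mul_of_nonneg_left h1 h2]

/-- If every `S i` contains a colour, few colourings `j` have `j i ∈ S i` for at most `t` many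
indices `i`. -/
lemma card_colourings_few_hits_le {ι : Type*} [Fintype ι] [DecidableEq ι] {r : ℕ} (hr : 0 < r)
    (S : ι → Finset (Fin r)) (hS : ∀ i, (S i).Nonempty) {x t : ℝ} (hx : 0 ≤ x) :
    ((Finset.univ.filter fun j : ι → Fin r =>
        ((Finset.univ.filter fun i => j i ∈ S i).card : ℝ) ≤ t).card : ℝ) ≤
      (r : ℝ) ^ Fintype.card ι *
        Real.exp (x * t - Fintype.card ι * ((x - x ^ 2) / r)) := by
  have hr' : (0 : ℝ) < r := by exact_mod_cast hr
  -- Exponential Markov: the product of the `g i (j i)` is exp(-x · hits), and its sum over all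
  -- colourings factors over `i`.
  set g : ι → Fin r → ℝ := fun i k => if k ∈ S i then Real.exp (-x) else 1 with hg
  have hprod : ∀ j : ι → Fin r, ∏ i, g i (j i) =
      Real.exp (-x * (Finset.univ.filter fun i => j i ∈ S i).card) := by
    intro j
    simp only [hg, Finset.prod_ite, Finset.prod_const, one_pow, mul_one]
    rw [← Real.exp_nat_mul, mul_comm]
  have hfactor : ∀ i, ∑ k, g i k ≤ r * Real.exp (-((x - x ^ 2) / r)) := by
    intro i
    obtain ⟨k₀, hk₀⟩ := hS i
    have hle : ∀ k, g i k ≤ 1 := by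
      intro k
      simp only [hg]
      split_ifs
      · exact Real.exp_le_one_iff.2 (by linarith)
      · exact le_rfl
    have h1 : ∑ k, g i k ≤ Real.exp (-x) + (r - 1) := by
      rw [← Finset.add_sum_erase _ _ (Finset.mem_univ k₀)]
      have h2 : ∑ k ∈ Finset.univ.erase k₀, g i k ≤ ∑ k ∈ Finset.univ.erase k₀, (1 : ℝ) :=
        Finset.sum_le_sum fun k _ => hle k
      have h3 : ∑ k ∈ Finset.univ.erase k₀, (1 : ℝ) = r - 1 := by
        simp [Finset.card_erase_of_mem, Nat.cast_sub (Nat.succ_le_of_lt hr)]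
      have h4 : g i k₀ = Real.exp (-x) := by simp [hg, hk₀]
      linarith
    have h5 := Real.add_one_le_exp (-((x - x ^ 2) / r))
    have h6 : (r : ℝ) * (-((x - x ^ 2) / r) + 1) = r - (x - x ^ 2) := by field_simp; ring
    have h7 := mul_le_mul_of_nonneg_left h5 hr'.le
    have h8 := exp_neg_le_one_sub_add_sq hx
    linarith
  have hsum : ∑ j : ι → Fin r, ∏ i, g i (j i) ≤
      (r * Real.exp (-((x - x ^ 2) / r))) ^ Fintype.card ι := by
    rw [← Fintype.prod_sum, ← Finset.card_univ, ← Finset.prod_const]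
    refine Finset.prod_le_prod (fun i _ => Finset.sum_nonneg fun k _ => ?_) fun i _ => hfactor i
    simp only [hg]
    split_ifs <;> positivity
  set B := Finset.univ.filter fun j : ι → Fin r =>
    ((Finset.univ.filter fun i => j i ∈ S i).card : ℝ) ≤ t with hB
  have hlow : (B.card : ℝ) * Real.exp (-x * t) ≤ ∑ j : ι → Fin r, ∏ i, g i (j i) := by
    rw [← nsmul_eq_mul, ← Finset.sum_const]
    refine (Finset.sum_le_sum fun j hj => ?_).trans
      (Finset.sum_le_sum_of_subset_of_nonneg (Finset.subset_univ B) fun j _ _ => ?_)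
    · rw [hprod, Real.exp_le_exp]
      have := (Finset.mem_filter.1 hj).2
      nlinarith
    · rw [hprod]
      positivity
  have hB' : (B.card : ℝ) = B.card * Real.exp (-x * t) * Real.exp (x * t) := by
    rw [mul_assoc, ← Real.exp_add]
    simp
  rw [hB']
  refine (mul_le_mul_of_nonneg_right (hlow.trans hsum) (Real.exp_pos _).le).trans_eq ?_
  rw [mul_pow, ← Real.exp_nat_mul, mul_assoc, ← Real.exp_add]
  congr 2
  ring

/-- If every member of a small family contains a pair `(i, k)` for every `i`, then the graph of a
single colouring meets all members in nearly a `1 / r` fraction of the indices. -/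
lemma exists_colouring_many_hits {ι : Type*} [Fintype ι] [DecidableEq ι] {r : ℕ} (hr : 0 < r)
    (𝒜 : Finset (Finset (ι × Fin r))) (h𝒜 : ∀ s ∈ 𝒜, ∀ i, ∃ k, (i, k) ∈ s) {ε : ℝ} (hε : 0 < ε)
    (hcard : (𝒜.card : ℝ) * Real.exp (-(Fintype.card ι * (ε ^ 2 / 4))) < 1) :
    ∃ j : ι → Fin r, ∀ s ∈ 𝒜, (Fintype.card ι : ℝ) / r - ε * Fintype.card ι <
      (Finset.univ.filter fun i => (i, j i) ∈ s).card := by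
  by_contra! hcon
  have hr1 : (1 : ℝ) ≤ r := by exact_mod_cast hr
  have hr' : (0 : ℝ) < r := by linarith
  set n := Fintype.card ι with hn
  have hcover : (Finset.univ : Finset (ι → Fin r)) ⊆ 𝒜.biUnion fun s =>
      Finset.univ.filter fun j : ι → Fin r =>
        ((Finset.univ.filter fun i => (i, j i) ∈ s).card : ℝ) ≤ (n : ℝ) / r - ε * n := by
    intro j _
    obtain ⟨s, hs, hj⟩ := hcon j
    simpa using ⟨s, hs, hj⟩
  have hbound : ∀ s ∈ 𝒜, ((Finset.univ.filter fun j : ι → Fin r =>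
        ((Finset.univ.filter fun i => (i, j i) ∈ s).card : ℝ) ≤ (n : ℝ) / r - ε * n).card : ℝ) ≤
      (r : ℝ) ^ n * Real.exp (-(n * (ε ^ 2 / 4))) := by
    intro s hs
    have h := card_colourings_few_hits_le hr
      (fun i => Finset.univ.filter fun k => (i, k) ∈ s)
      (fun i => by obtain ⟨k, hk⟩ := h𝒜 s hs i; exact ⟨k, by simpa using hk⟩)
      -- This `x` minimises n(x² - εx), which bounds the exponent; the minimum is -nε²/4.
      (x := ε / 2) (t := (n : ℝ) / r - ε * n) (by positivity)
    simp only [Finset.mem_filter, Finset.mem_univ, true_and] at h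
    refine h.trans (mul_le_mul_of_nonneg_left (Real.exp_le_exp.2 ?_) (by positivity))
    have h1 : (n : ℝ) * ((ε / 2) ^ 2 / r) ≤ n * (ε / 2) ^ 2 :=
      mul_le_mul_of_nonneg_left (div_le_self (by positivity) hr1) (by positivity)
    have h2 : ε / 2 * ((n : ℝ) / r - ε * n) - n * ((ε / 2 - (ε / 2) ^ 2) / r) =
      n * ((ε / 2) ^ 2 / r) - n * (ε ^ 2 / 2) := by ring
    rw [← hn, h2]
    nlinarith
  have htotal : (r : ℝ) ^ n ≤ 𝒜.card * ((r : ℝ) ^ n * Real.exp (-(n * (ε ^ 2 / 4)))) := by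
    have h1 := (Finset.card_le_card hcover).trans Finset.card_biUnion_le
    rw [Finset.card_univ, Fintype.card_fun, Fintype.card_fin] at h1
    have h2 : (r : ℝ) ^ n ≤ ∑ s ∈ 𝒜, ((Finset.univ.filter fun j : ι → Fin r =>
        ((Finset.univ.filter fun i => (i, j i) ∈ s).card : ℝ) ≤
          (n : ℝ) / r - ε * n).card : ℝ) := by exact_mod_cast h1
    refine (h2.trans (Finset.sum_le_sum hbound)).trans_eq ?_
    simp
  have hpow : (0 : ℝ) < (r : ℝ) ^ n := by positivity
  nlinarith

/-! ### Sarkaria's transformation -/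

section Sarkaria

variable {E : Type*} [NormedAddCommGroup E] [NormedSpace ℝ E] {r : ℕ}

/-- The lift of the point `x` with colour `k`: the tensor of `(x, 1)` with the `k`-th vertex of a
regular simplex centred at the origin. -/
noncomputable def sarkariaLift (x : E) (k : Fin r) : Fin r → E × ℝ :=
  fun l => ((if k = l then 1 else 0) - (r : ℝ)⁻¹) • (x, (1 : ℝ))

lemma sum_sarkariaLift (x : E) : ∑ k : Fin r, sarkariaLift x k = 0 := by
  ext1 l
  have hr : (r : ℝ) ≠ 0 := by
    have := l.pos
    positivity
  simp only [Finset.sum_apply, sarkariaLift, ← Finset.sum_smul]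
  simp [hr]

lemma exists_nonneg_sarkariaLift (hr : 0 < r) (φ : (Fin r → E × ℝ) →ₗ[ℝ] ℝ) (x : E) :
    ∃ k, 0 ≤ φ (sarkariaLift x k) := by
  by_contra! h
  have : ∑ k, φ (sarkariaLift x k) < 0 :=
    Finset.sum_neg (fun k _ => h k) ⟨⟨0, hr⟩, Finset.mem_univ _⟩
  rw [← map_sum, sum_sarkariaLift, map_zero] at this
  exact this.false

/-- If the origin is in the convex hull of the lifts of a coloured set, then the convex hulls of the
colour classes have a common point. -/
lemma nonempty_iInter_convexHull_of_zero_mem (hr : 0 < r) (j : E → Fin r) (s : Set E)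
    (h : 0 ∈ convexHull ℝ ((fun x => sarkariaLift x (j x)) '' s)) :
    (⋂ k, convexHull ℝ {x ∈ s | j x = k}).Nonempty := by
  classical
  have hr' : (0 : ℝ) < r := by exact_mod_cast hr
  rw [convexHull_eq] at h
  obtain ⟨ι, t, w, z, hw, hw1, hz, hc⟩ := h
  rw [Finset.centerMass_eq_of_sum_1 _ _ hw1] at hc
  have hz' : ∀ i, ∃ x, i ∈ t → x ∈ s ∧ sarkariaLift x (j x) = z i := by
    intro i
    by_cases hi : i ∈ t
    · obtain ⟨x, hx⟩ := hz i hi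
      exact ⟨x, fun _ => hx⟩
    · exact ⟨0, fun h => (hi h).elim⟩
  choose y hy using hz'
  -- Coordinate `k` of the vanishing combination: each colour class carries the same share 1/r of
  -- the sum of the weighted (y, 1). Hence all classes have the same centre of mass.
  have hbal : ∀ k, ∑ i ∈ t with j (y i) = k, w i • (y i, (1 : ℝ)) =
      (r : ℝ)⁻¹ • ∑ i ∈ t, w i • (y i, (1 : ℝ)) := by
    intro k
    have h1 := congrFun hc k
    rw [Finset.sum_apply] at h1
    have h2 : ∀ i ∈ t, (w i • z i) k = (if j (y i) = k then w i • (y i, (1 : ℝ)) else 0) -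
        (r : ℝ)⁻¹ • w i • (y i, (1 : ℝ)) := by
      intro i hi
      rw [← (hy i hi).2, Pi.smul_apply, sarkariaLift, smul_comm, sub_smul]
      split_ifs <;> simp
    rw [Finset.sum_congr rfl h2, Finset.sum_sub_distrib, ← Finset.smul_sum,
      ← Finset.sum_filter] at h1
    exact sub_eq_zero.1 h1
  refine ⟨∑ i ∈ t, w i • y i, Set.mem_iInter.2 fun k => ?_⟩
  have hweight : ∑ i ∈ t with j (y i) = k, w i = (r : ℝ)⁻¹ := by
    have := congrArg Prod.snd (hbal k)
    simpa [Prod.snd_sum, hw1] using this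
  have hpoint : ∑ i ∈ t with j (y i) = k, w i • y i = (r : ℝ)⁻¹ • ∑ i ∈ t, w i • y i := by
    have := congrArg Prod.fst (hbal k)
    simpa [Prod.fst_sum] using this
  have hmass : (t.filter fun i => j (y i) = k).centerMass w y = ∑ i ∈ t, w i • y i := by
    rw [Finset.centerMass, hweight, hpoint, smul_smul, inv_inv, mul_inv_cancel₀ hr'.ne', one_smul]
  rw [← hmass]
  refine Finset.centerMass_mem_convexHull _ (fun i hi => hw i (Finset.mem_filter.1 hi).1)
    (by rw [hweight]; positivity) fun i hi => ?_
  exact ⟨(hy i (Finset.mem_filter.1 hi).1).1, (Finset.mem_filter.1 hi).2⟩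

lemma zero_mem_convexHull_of_forall_exists_nonneg {F : Type*} [NormedAddCommGroup F]
    [NormedSpace ℝ F] {s : Set F} (hs : s.Finite)
    (h : ∀ φ : F →ₗ[ℝ] ℝ, ∃ x ∈ s, 0 ≤ φ x) : 0 ∈ convexHull ℝ s := by
  by_contra h0
  obtain ⟨φ, u, hφ, hu⟩ := geometric_hahn_banach_closed_point (convex_convexHull ℝ s)
    (hs.isCompact_convexHull ℝ).isClosed h0
  obtain ⟨x, hx, hx0⟩ := h φ
  have h1 := hφ x (subset_convexHull ℝ s hx)
  rw [map_zero] at hu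
  have h2 : (0 : ℝ) ≤ φ x := hx0
  linarith

end Sarkaria

/-! ### Tolerant partitions -/

section Tolerance

variable {d r : ℕ}

/-- Deleting t points empties no half-space, so 0 cannot be separated from the remaining lifts. -/
lemma mem_toleranceSet_of_many_hits (hr : 0 < r) (X : Finset (EuclideanSpace ℝ (Fin d)))
    (j : X → Fin r) (t : ℕ)
    (h : ∀ φ : (Fin r → EuclideanSpace ℝ (Fin d) × ℝ) →ₗ[ℝ] ℝ,
      t < (Finset.univ.filter fun x : X => 0 ≤ φ (sarkariaLift x.1 (j x))).card) :
    t ∈ toleranceSet X r := by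
  classical
  set c : EuclideanSpace ℝ (Fin d) → Fin r :=
    fun x => if hx : x ∈ X then j ⟨x, hx⟩ else ⟨0, hr⟩ with hc
  have hcj : ∀ x : X, c x = j x := fun x => by simp [hc]
  refine ⟨fun k => X.filter fun x => c x = k, ⟨fun k l hkl => ?_, ?_⟩, fun Y _ hYt => ?_⟩
  · refine Finset.disjoint_left.2 fun x hx hx' => hkl ?_
    rw [← (Finset.mem_filter.1 hx).2, (Finset.mem_filter.1 hx').2]
  · ext x
    simp
  · have hset : ∀ k, ((X.filter fun x => c x = k : Finset _) : Set (EuclideanSpace ℝ (Fin d))) \ Y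
        = {x ∈ (X : Set (EuclideanSpace ℝ (Fin d))) \ Y | c x = k} := by
      intro k
      ext x
      simp only [Set.mem_sdiff, Finset.mem_coe, Finset.mem_filter, Set.mem_ofPred_eq]
      tauto
    simp only [hset]
    refine nonempty_iInter_convexHull_of_zero_mem hr c _
      (zero_mem_convexHull_of_forall_exists_nonneg
        ((X.finite_toSet.subset Set.sdiff_subset).image _) fun φ => ?_)
    have hlt := hYt.trans_lt (h φ)
    rw [← Finset.card_map (Function.Embedding.subtype _)] at hlt
    obtain ⟨x, hx, hxY⟩ := Finset.exists_mem_notMem_of_card_lt_card hlt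
    obtain ⟨x', hx', rfl⟩ := Finset.mem_map.1 hx
    refine ⟨_, ⟨x'.1, ⟨x'.2, hxY⟩, rfl⟩, ?_⟩
    simpa [hcj] using hx'

/-- Removing all of `X` leaves empty hulls; this bound makes the supremum a maximum. -/
lemma lt_card_of_mem_toleranceSet (hr : 0 < r) {X : Finset (EuclideanSpace ℝ (Fin d))} {t : ℕ}
    (ht : t ∈ toleranceSet X r) : t < X.card := by
  obtain ⟨A, hA, hT⟩ := ht
  by_contra! hle
  obtain ⟨y, hy⟩ := hT X subset_rfl hle
  have hy0 := Set.mem_iInter.1 hy ⟨0, hr⟩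
  have hsub : ((A ⟨0, hr⟩ : Set (EuclideanSpace ℝ (Fin d))) \ X) = ∅ := by
    rw [Set.sdiff_eq_empty, ← hA.2]
    exact Set.subset_iUnion (fun i => (A i : Set (EuclideanSpace ℝ (Fin d)))) ⟨0, hr⟩
  rw [hsub, convexHull_empty] at hy0
  exact hy0

lemma isGreatest_tolerance (hr : 0 < r) {X : Finset (EuclideanSpace ℝ (Fin d))}
    (hne : (toleranceSet X r).Nonempty) : IsGreatest (toleranceSet X r) (tolerance X r) := by
  have hbdd : BddAbove (toleranceSet X r) :=
    ⟨X.card, fun t ht => (lt_card_of_mem_toleranceSet hr ht).le⟩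
  exact ⟨Nat.sSup_mem hne hbdd, fun t ht => le_csSup hbdd ht⟩

lemma isLeast_minTolerance (hd : 0 < d) (n : ℕ) :
    IsLeast (toleranceValues n d r) (minTolerance n d r) := by
  have : Nonempty (Fin d) := ⟨⟨0, hd⟩⟩
  have : Infinite (EuclideanSpace ℝ (Fin d)) := Module.Free.infinite ℝ _
  obtain ⟨X, hX⟩ := Infinite.exists_subset_card_eq (EuclideanSpace ℝ (Fin d)) n
  exact ⟨Nat.sInf_mem ⟨tolerance X r, X, hX, rfl⟩, fun t ht => Nat.sInf_le ht⟩

lemma eventually_poly_mul_exp_lt_one (a b D : ℕ) {δ : ℝ} (hδ : 0 < δ) :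
    ∀ᶠ n : ℕ in atTop, (a : ℝ) * (n * b + 1) ^ D * Real.exp (-(n * δ)) < 1 := by
  have h1 := ((Real.summable_pow_mul_exp_neg_nat_mul D hδ).tendsto_atTop_zero.const_mul
    ((a : ℝ) * (b + 1) ^ D)).eventually_lt_const (u := 1) (by simp)
  filter_upwards [h1, eventually_ge_atTop 1] with n hn hn1
  have hn1' : (1 : ℝ) ≤ n := by exact_mod_cast hn1
  refine lt_of_le_of_lt ?_ hn
  have h2 : ((n : ℝ) * b + 1) ^ D ≤ ((b + 1) * n) ^ D :=
    pow_le_pow_left₀ (by positivity) (by linarith) D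
  rw [mul_pow] at h2
  calc (a : ℝ) * (n * b + 1) ^ D * Real.exp (-(n * δ))
      ≤ a * ((b + 1) ^ D * n ^ D) * Real.exp (-(n * δ)) := by gcongr
    _ = a * (b + 1) ^ D * (n ^ D * Real.exp (-δ * n)) := by
        rw [show -((n : ℝ) * δ) = -δ * n by ring]
        ring

lemma eventually_exists_mem_toleranceSet (d : ℕ) (hr : 0 < r) {ε : ℝ} (hε : 0 < ε) :
    ∀ᶠ n : ℕ in atTop, ∀ X : Finset (EuclideanSpace ℝ (Fin d)), X.card = n →
      ∃ t ∈ toleranceSet X r, (n : ℝ) / r - ε * n ≤ t := by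
  classical
  have hr' : (0 : ℝ) < r := by exact_mod_cast hr
  -- The bound ε/2 leaves room for the floor, which loses at most 1 ≤ εn/2; the bound 1/r keeps n/r
  -- - ε'n nonnegative.
  set ε' : ℝ := min (ε / 2) (r : ℝ)⁻¹ with hε'
  have hpos : 0 < ε' := by positivity
  set D := Module.finrank ℝ (Fin r → EuclideanSpace ℝ (Fin d) × ℝ) with hD
  filter_upwards [eventually_poly_mul_exp_lt_one (D + 1) r D (δ := ε' ^ 2 / 4) (by positivity),
    (tendsto_natCast_atTop_atTop (R := ℝ)).eventually_ge_atTop (2 / ε)] with n hn hnε X hX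
  have hcardX : Fintype.card X = n := by simp [hX]
  set p : X × Fin r → (Fin r → EuclideanSpace ℝ (Fin d) × ℝ) :=
    fun a => sarkariaLift a.1.1 a.2 with hp
  obtain ⟨j, hj⟩ := exists_colouring_many_hits hr (halfSpaceTraces p) (by
      intro s hs x
      obtain ⟨φ, hφ⟩ := mem_halfSpaceTraces.1 hs
      obtain ⟨k, hk⟩ := exists_nonneg_sarkariaLift hr φ x.1
      exact ⟨k, (hφ _).2 hk⟩) hpos (by
      have h1 := card_halfSpaceTraces_le p
      rw [← hD, Fintype.card_prod, Fintype.card_fin, hcardX] at h1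
      have h2 : ((halfSpaceTraces p).card : ℝ) ≤ ((D + 1 : ℕ) : ℝ) * (n * r + 1) ^ D := by
        exact_mod_cast h1
      rw [hcardX]
      exact (mul_le_mul_of_nonneg_right h2 (Real.exp_pos _).le).trans_lt hn)
  rw [hcardX] at hj
  have hnn : 0 ≤ (n : ℝ) / r - ε' * n := by
    have : ε' * n ≤ (r : ℝ)⁻¹ * n :=
      mul_le_mul_of_nonneg_right (min_le_right _ _) (Nat.cast_nonneg n)
    rw [div_eq_inv_mul]
    linarith
  refine ⟨⌊(n : ℝ) / r - ε' * n⌋₊, mem_toleranceSet_of_many_hits hr X j _ fun φ => ?_, ?_⟩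
  · have h1 := hj (Finset.univ.filter fun a => 0 ≤ φ (p a))
      (mem_halfSpaceTraces.2 ⟨φ, fun a => by simp⟩)
    simp only [Finset.mem_filter, Finset.mem_univ, true_and, hp] at h1
    rw [Nat.floor_lt hnn]
    exact h1
  · have h1 := (Nat.lt_floor_add_one ((n : ℝ) / r - ε' * n)).le
    have h2 : ε' * n ≤ ε / 2 * n :=
      mul_le_mul_of_nonneg_right (min_le_left _ _) (Nat.cast_nonneg n)
    have h3 : 2 ≤ n * ε := (div_le_iff₀ hε).1 hnε
    linarith

end Tolerance

theorem mainTheorem2 (r d : ℕ) (hr : 0 < r) (hd : 0 < d) :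
    ∃ f : ℕ → ℝ, f =o[atTop] (fun n : ℕ => (n : ℝ)) ∧
      ∀ᶠ n : ℕ in atTop,
        (∀ X : Finset (EuclideanSpace ℝ (Fin d)), X.card = n →
          IsGreatest (toleranceSet X r) (tolerance X r)) ∧
        IsLeast (toleranceValues n d r) (minTolerance n d r) ∧
        (n : ℝ) / (r : ℝ) - f n ≤ (minTolerance n d r : ℝ) := by
  -- Truncation at 0 means that only an upper bound on `f` is needed for the little-o.
  refine ⟨fun n => max 0 ((n : ℝ) / r - minTolerance n d r), ?_, ?_⟩
  · rw [isLittleO_iff]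
    intro ε hε
    filter_upwards [eventually_exists_mem_toleranceSet d hr hε] with n hn
    obtain ⟨X, hX, ht⟩ := (isLeast_minTolerance (r := r) hd n).1
    obtain ⟨t, htX, hle⟩ := hn X hX
    have h1 : (t : ℝ) ≤ minTolerance n d r := by
      rw [ht]
      exact_mod_cast (isGreatest_tolerance hr ⟨t, htX⟩).2 htX
    rw [Real.norm_of_nonneg (le_max_left _ _), Real.norm_natCast]
    exact max_le (by positivity) (by linarith)
  -- Any ε serves here: only nonemptiness of `toleranceSet X r` is used.
  · filter_upwards [eventually_exists_mem_toleranceSet d hr one_pos] with n hn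
    refine ⟨fun X hX => ?_, isLeast_minTolerance hd n, ?_⟩
    · obtain ⟨t, htX, -⟩ := hn X hX
      exact isGreatest_tolerance hr ⟨t, htX⟩
    · have := le_max_right 0 ((n : ℝ) / r - minTolerance n d r)
      linarith
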